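/- Let $d\ge 1$. For $\theta=(\theta_1,\dots,\theta_d)\in(\mathbb R/2\pi\mathbb Z)^d$ put $|\theta\rangle=\frac1{\sqrt d}\sum_k e^{i\theta_k}|k\rangle\in\mathbb C^d$, $\rho_\theta=|\theta\rangle\langle\theta|$ and $U(\theta)=\sum_k e^{i\theta_k}|k\rangle\langle k|$; let $\mu$ be the Haar probability measure on $(\mathbb R/2\pi\mathbb Z)^d$. Let $F(\rho,\sigma)=(\operatorname{tr}\sqrt{\sqrt\rho\,\sigma\sqrt\rho})^2$. For an ideal map $\mathcal E_{\rm ideal}$, given on the states $\rho_\theta$, the process fidelity of a quantum channel (completely positive trace-preserving map) $\mathcal E:B(\mathbb C^d)\to B(\mathbb C^d\otimes\mathbb C^d)$ is $\int F(\mathcal E_{\rm ideal}(\rho_\theta),\mathcal E(\rho_\theta))\,d\mu(\theta)$. The optimal process fidelity is the maximum of this over all channels, and a channel attaining it is called optimal. Consider the phase-covariant cloner $\rho_\theta\mapsto\rho_\theta\otimes\rho_\theta$, the hybrid map $\rho_\theta\mapsto\rho_\theta\otimes\rho_{-\theta}$, and the hybrid map with its outputs in the other order, $\rho_\theta\mapsto\rho_{-\theta}\otimes\rho_\theta$.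 Let $J(\mathcal E)=\sum_{i,j}|i\rangle\langle j|\otimes\mathcal E(|i\rangle\langle j|)$ be the Choi operator (system 1 is the input, systems 2 and 3 are the outputs), let $V_{(ab)}$ be the swap of systems $a$ and $b$, and $U_\pi=\sum_k|\pi(k)\rangle\langle k|$ for $\pi\in S_d$. The averaged Choi operator of $\mathcal E$ is $$\widetilde J(\mathcal E)=\frac1{2\,d!}\sum_{\pi\in S_d}\ \sum_{V\in\{\mathbb 1,V_\ast\}} V\,U_\pi^{\otimes3}\Big(\int W(\theta)J(\mathcal E)W(-\theta)\,d\mu(\theta)\Big)U_\pi^{\dagger\otimes 3}\,V^\dagger ,$$ where the second sum always has two terms and - for the cloner, $W(\theta)=U(\theta)\otimes U(-\theta)\otimes U(-\theta)$ and $V_\ast=V_{(23)}$; - for the hybrid map $\rho_\theta\mapsto\rho_\theta\otimes\rho_{-\theta}$, $W(\theta)=U(\theta)\otimes U(-\theta)\otimes U(\theta)$ and $V_\ast=V_{(13)}$; - for the hybrid map $\rho_\theta\mapsto\rho_{-\theta}\otimes\rho_\theta$, $W(\theta)=U(\theta)\otimes U(\theta)\otimes U(-\theta)$ and $V_\ast=V_{(12)}$.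 Then: 1. The phase-covariant cloner and both hybrid maps have optimal process fidelity $\dfrac{2d-1}{d^2}$. 2. If $\mathcal E_{\rm clone}$ is any optimal channel for the cloner and $\mathcal E_{\rm hybrid}$ any optimal channel for $\rho_\theta\mapsto\rho_\theta\otimes\rho_{-\theta}$, then $\widetilde J(\mathcal E_{\rm hybrid})=V_{(12)}\,\widetilde J(\mathcal E_{\rm clone})\,V_{(12)}$. 3. If $\mathcal E_{\rm clone}$ is any optimal channel for the cloner and $\mathcal E_{\rm hybrid}'$ any optimal channel for $\rho_\theta\mapsto\rho_{-\theta}\otimes\rho_\theta$, then $\widetilde J(\mathcal E_{\rm hybrid}')=V_{(13)}\,\widetilde J(\mathcal E_{\rm clone})\,V_{(13)}$. -/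

import Mathlib

open scoped Kronecker ComplexOrder

/-! ### Quantum channels and fidelity -/

/-- Complex square matrices with rows and columns indexed by `α`: the operators on `ℂ^α`. -/
abbrev Op (α : Type) : Type := Matrix α α ℂ

/-- The ampliation `id_n ⊗ E`, acting blockwise. -/
def ampliation {α β : Type} (n : ℕ) (E : Op α →ₗ[ℂ] Op β) (X : Op (Fin n × α)) :
    Op (Fin n × β) :=
  Matrix.of fun a b => E (Matrix.of fun i j => X (a.1, i) (b.1, j)) a.2 b.2

/-- Complete positivity: every ampliation maps positive semidefinite operators to positive
semidefinite operators. -/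
def IsCompletelyPositive {α β : Type} (E : Op α →ₗ[ℂ] Op β) : Prop :=
  ∀ (n : ℕ) (X : Op (Fin n × α)), X.PosSemidef → (ampliation n E X).PosSemidef

/-- A quantum channel: a completely positive and trace-preserving linear map. -/
structure IsChannel {α β : Type} [Fintype α] [Fintype β] (E : Op α →ₗ[ℂ] Op β) : Prop where
  completelyPositive : IsCompletelyPositive E
  tracePreserving : ∀ X : Op α, (E X).trace = X.trace

/-- The square root of a positive semidefinite matrix, by functional calculus. -/
noncomputable def opSqrt {α : Type} [Fintype α] [DecidableEq α] (A : Op α) : Op α :=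
  cfc Real.sqrt A

/-- The fidelity `F(ρ, σ) = (tr √(√ρ σ √ρ))²`. -/
noncomputable def fidelity {α : Type} [Fintype α] [DecidableEq α] (ρ σ : Op α) : ℝ :=
  (opSqrt (opSqrt ρ * σ * opSqrt ρ)).trace.re ^ 2

/-! ### Phase states -/

instance factTwoPiPos : Fact (0 < 2 * Real.pi) := ⟨Real.two_pi_pos⟩

/-- `d`-tuples of angles modulo `2π`: a compact group. -/
abbrev Angles (d : ℕ) : Type := Fin d → AddCircle (2 * Real.pi)

/-- The Haar probability measure on the group of `d`-tuples of angles. -/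
noncomputable def haarAngles (d : ℕ) : MeasureTheory.Measure (Angles d) :=
  MeasureTheory.Measure.addHaarMeasure ⊤

/-- The number `e^{i t}` of an angle `t`. -/
noncomputable def expI (t : AddCircle (2 * Real.pi)) : ℂ := (AddCircle.toCircle t : ℂ)

theorem expI_coe (x : ℝ) : expI (x : AddCircle (2 * Real.pi)) = Complex.exp (x * Complex.I) := by
  simp [expI, AddCircle.toCircle_apply_mk, Circle.coe_exp]

/-- The vector `|θ⟩ = d^{-1/2} ∑ₖ e^{i θₖ} |k⟩`. -/
noncomputable def phaseKet {d : ℕ} (θ : Angles d) : Fin d → ℂ :=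
  fun k => ((1 / Real.sqrt d : ℝ) : ℂ) * expI (θ k)

/-- The phase state `ρ_θ = |θ⟩⟨θ|`. -/
noncomputable def phaseState {d : ℕ} (θ : Angles d) : Op (Fin d) :=
  Matrix.vecMulVec (phaseKet θ) (star (phaseKet θ))

/-- Basis labels of the two output systems. -/
abbrev Two (d : ℕ) : Type := Fin d × Fin d

/-- Basis labels of three systems: system 1 is the input, systems 2 and 3 are the outputs. -/
abbrev Three (d : ℕ) : Type := Fin d × Two d

/-- `Eid` is the ideal phase-covariant cloner on phase states, `ρ_θ ↦ ρ_θ ⊗ ρ_θ`. -/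
def IsIdealCloner {d : ℕ} (Eid : Op (Fin d) → Op (Two d)) : Prop :=
  ∀ θ : Angles d, Eid (phaseState θ) = phaseState θ ⊗ₖ phaseState θ

/-- `Eid` is the ideal hybrid map on phase states, `ρ_θ ↦ ρ_θ ⊗ ρ_{-θ}`. -/
def IsIdealHybrid {d : ℕ} (Eid : Op (Fin d) → Op (Two d)) : Prop :=
  ∀ θ : Angles d, Eid (phaseState θ) = phaseState θ ⊗ₖ phaseState (-θ)

/-- `Eid` is the ideal hybrid map with its two outputs listed in the other order,
`ρ_θ ↦ ρ_{-θ} ⊗ ρ_θ`. -/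
def IsIdealHybridRev {d : ℕ} (Eid : Op (Fin d) → Op (Two d)) : Prop :=
  ∀ θ : Angles d, Eid (phaseState θ) = phaseState (-θ) ⊗ₖ phaseState θ

theorem expI_neg (t : AddCircle (2 * Real.pi)) : expI (-t) = star (expI t) := by
  rw [expI, AddCircle.toCircle_neg, Circle.coe_inv_eq_conj]
  rfl

theorem phaseState_neg {d : ℕ} (θ : Angles d) : phaseState (-θ) = (phaseState θ).transpose := by
  ext i j
  simp [phaseState, phaseKet, Matrix.vecMulVec_apply, expI_neg]
  ring

theorem isIdealHybrid_transpose (d : ℕ) :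
    IsIdealHybrid (fun ρ : Op (Fin d) => ρ ⊗ₖ ρ.transpose) := fun θ => by
  simp only [phaseState_neg]

theorem isIdealHybridRev_transpose (d : ℕ) :
    IsIdealHybridRev (fun ρ : Op (Fin d) => ρ.transpose ⊗ₖ ρ) := fun θ => by
  simp only [phaseState_neg]

/-! ### Process fidelity on phase states -/

/-- The process fidelity `∫ F(Eid(ρ_θ), E(ρ_θ)) dμ(θ)` on the phase states. -/
noncomputable def processFidelity {d : ℕ} (Eid : Op (Fin d) → Op (Two d))
    (E : Op (Fin d) →ₗ[ℂ] Op (Two d)) : ℝ :=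
  ∫ θ : Angles d, fidelity (Eid (phaseState θ)) (E (phaseState θ)) ∂(haarAngles d)

/-- `F` is the optimal process fidelity of `Eid`: the maximum over all quantum channels. -/
def IsOptimalProcessFidelity {d : ℕ} (Eid : Op (Fin d) → Op (Two d)) (F : ℝ) : Prop :=
  IsGreatest {f : ℝ | ∃ E : Op (Fin d) →ₗ[ℂ] Op (Two d),
    IsChannel E ∧ processFidelity Eid E = f} F

/-- `E` is an optimal approximation of `Eid` by a quantum channel. -/
def IsOptimalChannel {d : ℕ} (Eid : Op (Fin d) → Op (Two d))
    (E : Op (Fin d) →ₗ[ℂ] Op (Two d)) : Prop :=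
  IsChannel E ∧ IsOptimalProcessFidelity Eid (processFidelity Eid E)

/-! ### Averaged Choi operators -/

/-- The Choi operator `J(E) = ∑ᵢⱼ |i⟩⟨j| ⊗ E(|i⟩⟨j|)`. -/
noncomputable def choi {d : ℕ} (E : Op (Fin d) →ₗ[ℂ] Op (Two d)) : Op (Three d) :=
  ∑ i, ∑ j, Matrix.single i j (1 : ℂ) ⊗ₖ E (Matrix.single i j (1 : ℂ))

/-- The diagonal unitary `U(θ) = ∑ₖ e^{i θₖ} |k⟩⟨k|`. -/
noncomputable def phaseOp {d : ℕ} (θ : Angles d) : Op (Fin d) :=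
  Matrix.diagonal fun k => expI (θ k)

/-- The operator `∑ₐ |τ(a)⟩⟨a|` that moves basis vectors along `τ`. -/
def basisOp {α : Type} [DecidableEq α] (τ : α → α) : Op α :=
  Matrix.of fun a b => if a = τ b then 1 else 0

/-- `U_π ⊗ U_π ⊗ U_π`, where `U_π = ∑ₖ |π(k)⟩⟨k|`. -/
def permOp3 {d : ℕ} (π : Equiv.Perm (Fin d)) : Op (Three d) :=
  basisOp π ⊗ₖ (basisOp π ⊗ₖ basisOp π)

/-- The swap of systems 1 and 2. -/
def V12 (d : ℕ) : Op (Three d) := basisOp fun a => (a.2.1, (a.1, a.2.2))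

/-- The swap of systems 1 and 3. -/
def V13 (d : ℕ) : Op (Three d) := basisOp fun a => (a.2.2, (a.2.1, a.1))

/-- The swap of systems 2 and 3. -/
def V23 (d : ℕ) : Op (Three d) := basisOp fun a => (a.1, (a.2.2, a.2.1))

/-- The twirl `∫ W(θ) X W(-θ) dμ(θ)`, entry by entry. -/
noncomputable def twirl {d : ℕ} (W : Angles d → Op (Three d)) (X : Op (Three d)) :
    Op (Three d) :=
  Matrix.of fun a b => ∫ θ : Angles d, (W θ * X * W (-θ)) a b ∂(haarAngles d)

/-- The average of `V_σ U_π^{⊗3} 𝒯(X) U_π^{†⊗3} V_σ^†` over all permutations `π` of the basis and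
over `V_σ ∈ {𝟙, V}`, where `𝒯` is the twirl along `W`. -/
noncomputable def average {d : ℕ} (W : Angles d → Op (Three d)) (V : Op (Three d))
    (X : Op (Three d)) : Op (Three d) :=
  (1 / (2 * (d.factorial : ℂ))) • ∑ π : Equiv.Perm (Fin d),
    (permOp3 π * twirl W X * (permOp3 π).conjTranspose +
      V * (permOp3 π * twirl W X * (permOp3 π).conjTranspose) * V.conjTranspose)

/-- The averaged Choi operator for the cloner `ρ_θ ↦ ρ_θ ⊗ ρ_θ`: twirling along
`U(θ) ⊗ U(-θ) ⊗ U(-θ)`, symmetrization in systems 2 and 3. -/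
noncomputable def avgChoiCloner {d : ℕ} (E : Op (Fin d) →ₗ[ℂ] Op (Two d)) : Op (Three d) :=
  average (fun θ => phaseOp θ ⊗ₖ (phaseOp (-θ) ⊗ₖ phaseOp (-θ))) (V23 d) (choi E)

/-- The averaged Choi operator for the hybrid map `ρ_θ ↦ ρ_θ ⊗ ρ_{-θ}`: twirling along
`U(θ) ⊗ U(-θ) ⊗ U(θ)`, symmetrization in systems 1 and 3. -/
noncomputable def avgChoiHybrid {d : ℕ} (E : Op (Fin d) →ₗ[ℂ] Op (Two d)) : Op (Three d) :=
  average (fun θ => phaseOp θ ⊗ₖ (phaseOp (-θ) ⊗ₖ phaseOp θ)) (V13 d) (choi E)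

/-- The averaged Choi operator for the hybrid map `ρ_θ ↦ ρ_{-θ} ⊗ ρ_θ`: twirling along
`U(θ) ⊗ U(θ) ⊗ U(-θ)`, symmetrization in systems 1 and 2. -/
noncomputable def avgChoiHybridRev {d : ℕ} (E : Op (Fin d) →ₗ[ℂ] Op (Two d)) : Op (Three d) :=
  average (fun θ => phaseOp θ ⊗ₖ (phaseOp θ ⊗ₖ phaseOp (-θ))) (V12 d) (choi E)

open Matrix

/-! ### Fidelity with a pure state -/

/-! The targets are pure states, so the fidelity is an expectation value, and integrating over the
angles kills every nontrivial character. Give the label `x = (i, a, b)` the weight `e_i - s e_a - t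
e_b`, with `(s, t)` equal to `(1, 1)`, `(1, -1)` or `(-1, 1)`. The process fidelity is then `d⁻³`
times the sum of `Re J x y` over pairs of equal weight (`processFidelity_eq_sum`).

The Choi operator `J` is positive semidefinite of trace `d`, so `Re J x y + Re J y x ≤ J x x + J y
y`, and the sum is at most `d` times the size of the largest weight fiber. For the cloner the
largest fibers are those of the weights `-e_b`, of size `2d - 1`; this is the upper bound
(`Matrix.PosSemidef.sum_fiber_re_le`). Equality forces `J` to be constant on each fiber block and to
vanish on the diagonal outside the largest fibers (`Matrix.PosSemidef.eq_of_sum_fiber_re`).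
Permutations act transitively on the `d` largest fibers, so averaging leaves only `optimalChoi`
(`IsCloningWeight.average_eq`), which is itself the Choi operator of a channel and attains the
bound.

Exchanging the input label with the output that carries `-θ` turns a hybrid weight into the negative
of the cloner weight. Fibers correspond, hence so do the optimal values and the averaged operators.
-/

theorem opSqrt_of_mul_self {α : Type} [Fintype α] [DecidableEq α] {A : Op α} {c : ℝ}
    (hA : A.IsHermitian) (hc : 0 ≤ c) (h : A * A = (c : ℂ) • A) :
    opSqrt A = ((Real.sqrt c / c : ℝ) : ℂ) • A := by
  have hs : IsSelfAdjoint A := hA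
  -- The spectrum lies in `{0, c}`, where the square root agrees with the linear function of slope
  -- `√c / c`; for `c = 0` this slope is `0` by convention.
  have hspec : ∀ x ∈ spectrum ℝ A, x * x = c * x := by
    intro x hx
    have h0 : Polynomial.aeval A (Polynomial.X ^ 2 - Polynomial.C c * Polynomial.X) = 0 := by
      simp only [map_sub, map_mul, Polynomial.aeval_X, Polynomial.aeval_C, pow_two, h]
      rw [← Algebra.smul_def]
      ext i j
      simp
    have h1 := spectrum.subset_polynomial_aeval A
      (Polynomial.X ^ 2 - Polynomial.C c * Polynomial.X) ⟨x, hx, rfl⟩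
    rw [h0] at h1
    have h2 : Nontrivial (Op α) := by
      by_contra hn
      rw [not_nontrivial_iff_subsingleton] at hn
      simp [spectrum.of_subsingleton] at hx
    rw [spectrum.zero_eq] at h1
    simp at h1
    linarith
  have hcongr : opSqrt A = cfc (fun x : ℝ => (Real.sqrt c / c) * x) A := by
    refine cfc_congr fun x hx => ?_
    have hx' := hspec x hx
    rcases eq_or_ne x 0 with rfl | hx0
    · simp
    · have : x = c := mul_right_cancel₀ hx0 hx'
      subst this
      simp [hx0]
  rw [hcongr, cfc_const_mul_id _ A hs]
  ext i j
  simp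

/-- A rank-one projection `P` is its own square root, and `P σ P = c P` with `c` the expectation
value, whose square root has trace `√c`. -/
theorem fidelity_pure {α : Type} [Fintype α] [DecidableEq α] {ψ : α → ℂ} {σ : Op α}
    (hψ : star ψ ⬝ᵥ ψ = 1) (hσ : σ.PosSemidef) :
    fidelity (vecMulVec ψ (star ψ)) σ = (star ψ ⬝ᵥ (σ *ᵥ ψ)).re := by
  set P : Op α := vecMulVec ψ (star ψ) with hP
  have hPP : P * P = P := by
    rw [hP, vecMulVec_mul_vecMulVec, hψ, one_smul]
  have hH : P.IsHermitian := by
    ext i j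
    simp [hP, vecMulVec_apply, mul_comm]
  have hsq : opSqrt P = P := by
    rw [opSqrt_of_mul_self (c := 1) hH zero_le_one (by simp [hPP])]
    simp
  have hc : 0 ≤ star ψ ⬝ᵥ (σ *ᵥ ψ) := hσ.dotProduct_mulVec_nonneg ψ
  obtain ⟨hre, him⟩ := Complex.le_def.1 hc
  set c : ℝ := (star ψ ⬝ᵥ (σ *ᵥ ψ)).re with hcdef
  have hcc : star ψ ⬝ᵥ (σ *ᵥ ψ) = (c : ℂ) := by
    apply Complex.ext <;> simp [hcdef]
    simpa using him.symm
  have hPσP : P * σ * P = (c : ℂ) • P := by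
    rw [← hcc, hP, Matrix.mul_assoc, mul_vecMulVec, vecMulVec_mul_vecMulVec, vecMulVec_smul]
  have htr : P.trace = 1 := by
    rw [hP, trace_vecMulVec, dotProduct_comm, hψ]
  have hre : 0 ≤ c := by simpa using hre
  have hPσP' : (P * σ * P).IsHermitian := by
    rw [hPσP]
    ext i j
    simp [hP, vecMulVec_apply, mul_comm]
  rw [fidelity, hsq, opSqrt_of_mul_self (c := c) hPσP' hre, hPσP, trace_smul, trace_smul, htr]
  · simp only [smul_eq_mul, mul_one, ← Complex.ofReal_mul, Complex.ofReal_re]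
    rcases hre.eq_or_lt with h0 | h0
    · simp [← h0]
    · rw [div_mul_cancel₀ _ h0.ne', Real.sq_sqrt hre]
  · rw [hPσP]
    simp [smul_smul, hPP]

/-! ### Channels and Choi operators -/

theorem IsChannel.posSemidef {α β : Type} [Fintype α] [Fintype β] {E : Op α →ₗ[ℂ] Op β}
    (hE : IsChannel E) {X : Op α} (hX : X.PosSemidef) : (E X).PosSemidef := by
  have h := hE.completelyPositive 1 (X.submatrix Prod.snd Prod.snd) (hX.submatrix _)
  exact h.submatrix fun b => ((0 : Fin 1), b)

theorem choi_apply {d : ℕ} (E : Op (Fin d) →ₗ[ℂ] Op (Two d)) (x y : Three d) :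
    choi E x y = E (single x.1 y.1 1) x.2 y.2 := by
  simp only [choi, Matrix.sum_apply, kroneckerMap_apply]
  rw [Finset.sum_eq_single x.1, Finset.sum_eq_single y.1]
  · simp
  · intro j _ hj
    simp [single_apply_of_col_ne _ _ hj]
  · simp
  · intro i _ hi
    refine Finset.sum_eq_zero fun j _ => ?_
    simp [single_apply_of_row_ne hi]
  · simp

theorem apply_eq_sum_choi {d : ℕ} (E : Op (Fin d) →ₗ[ℂ] Op (Two d)) (X : Op (Fin d))
    (p q : Two d) : E X p q = ∑ i, ∑ j, X i j * choi E (i, p) (j, q) := by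
  conv_lhs => rw [matrix_eq_sum_single X]
  simp only [map_sum, Matrix.sum_apply, choi_apply]
  refine Finset.sum_congr rfl fun i _ => Finset.sum_congr rfl fun j _ => ?_
  have : single i j (X i j) = X i j • single i j (1 : ℂ) := by simp
  rw [this, map_smul, Matrix.smul_apply, smul_eq_mul]

/-- The Choi operator is the ampliation applied to the unnormalized maximally entangled state `∑ᵢ |i
i⟩`. -/
theorem IsChannel.posSemidef_choi {d : ℕ} {E : Op (Fin d) →ₗ[ℂ] Op (Two d)}
    (hE : IsChannel E) : (choi E).PosSemidef := by
  let v : Fin d × Fin d → ℂ := fun a => if a.1 = a.2 then 1 else 0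
  have h := hE.completelyPositive d _ (posSemidef_vecMulVec_self_star v)
  convert h using 1
  ext x y
  rw [choi_apply]
  simp only [ampliation, of_apply]
  refine congrFun (congrFun (congrArg E ?_) x.2) y.2
  ext i j
  simp only [single_apply, vecMulVec_apply, Pi.star_apply, v, of_apply]
  by_cases h1 : x.1 = i <;> by_cases h2 : y.1 = j <;> simp [h1, h2]

/-- This is the only consequence of trace preservation that the upper bound and the equality case
need. -/
theorem IsChannel.trace_choi {d : ℕ} {E : Op (Fin d) →ₗ[ℂ] Op (Two d)}
    (hE : IsChannel E) : (choi E).trace = d := by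
  have h : ∀ i : Fin d, ∑ p, choi E (i, p) (i, p) = 1 := fun i => by
    have := hE.tracePreserving (single i i 1)
    simpa [choi_apply, Matrix.trace] using this
  simp only [Matrix.trace, diag_apply, Fintype.sum_prod_type (α₁ := Fin d) (α₂ := Two d), h]
  simp

/-- The linear map with a given Choi operator. -/
noncomputable def ofChoi {d : ℕ} (J : Op (Three d)) : Op (Fin d) →ₗ[ℂ] Op (Two d) where
  toFun X := Matrix.of fun p q => ∑ i, ∑ j, X i j * J (i, p) (j, q)
  map_add' X Y := by
    ext p q
    simp [add_mul, Finset.sum_add_distrib]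
  map_smul' c X := by
    ext p q
    simp [Finset.mul_sum, mul_assoc]

theorem choi_ofChoi {d : ℕ} (J : Op (Three d)) : choi (ofChoi J) = J := by
  ext ⟨i, p⟩ ⟨j, q⟩
  simp [choi_apply, ofChoi, single_apply, ite_and]

theorem isChannel_ofChoi {d : ℕ} {J B : Op (Three d)} (hJ : J = Bᴴ * B)
    (htr : ∀ i j, ∑ p, J (i, p) (j, p) = if i = j then 1 else 0) : IsChannel (ofChoi J) where
  completelyPositive n X hX := by
    subst hJ
    -- Each row of `B`, reshaped into a matrix from outputs to inputs, is an adjoint Kraus operator;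
    -- `C r` is its tensor product with the identity on `Fin n`.
    let C : Three d → Matrix (Fin n × Fin d) (Fin n × Two d) ℂ := fun r =>
      Matrix.of fun a b => if a.1 = b.1 then B r (a.2, b.2) else 0
    have : ampliation n (ofChoi (Bᴴ * B)) X = ∑ r, (C r)ᴴ * X * C r := by
      ext ⟨m, p⟩ ⟨m', q⟩
      simp only [ampliation, ofChoi, LinearMap.coe_mk, AddHom.coe_mk, of_apply, Matrix.sum_apply,
        mul_apply, conjTranspose_apply, C, Finset.mul_sum, Finset.sum_mul,
        Fintype.sum_prod_type (α₁ := Fin n) (α₂ := Fin d)]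
      simp only [apply_ite star, star_zero, ite_mul, zero_mul, mul_ite, mul_zero]
      simp only [Finset.sum_ite_irrel, Finset.sum_const_zero, Finset.sum_ite_eq', Finset.mem_univ,
        if_true]
      rw [Finset.sum_comm' (t' := Finset.univ) (s' := fun _ => Finset.univ) (by simp)]
      rw [Finset.sum_congr rfl fun j _ => Finset.sum_comm, Finset.sum_comm]
      refine Finset.sum_congr rfl fun r _ => Finset.sum_congr rfl fun j _ =>
        Finset.sum_congr rfl fun i _ => ?_
      ring
    rw [this]
    exact posSemidef_sum _ fun r _ => hX.conjTranspose_mul_mul_same (C r)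
  tracePreserving X := by
    simp only [Matrix.trace, diag_apply, ofChoi, LinearMap.coe_mk, AddHom.coe_mk, of_apply]
    rw [Finset.sum_comm]
    refine Finset.sum_congr rfl fun i _ => ?_
    rw [Finset.sum_comm]
    simp [← Finset.mul_sum, htr]

/-! ### Basis permutations -/

theorem basisOp_conj_apply {α : Type} [Fintype α] [DecidableEq α] (e : α ≃ α) (A : Op α)
    (x y : α) : (basisOp e * A * (basisOp e)ᴴ) x y = A (e.symm x) (e.symm y) := by
  simp [basisOp, mul_apply, ← Equiv.symm_apply_eq]

theorem basisOp_conjTranspose_of_involutive {α : Type} [DecidableEq α] {v : α → α}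
    (hv : Function.Involutive v) : (basisOp v)ᴴ = basisOp v := by
  ext x y
  have : y = v x ↔ x = v y := ⟨fun h => by rw [h, hv], fun h => by rw [h, hv]⟩
  simp [basisOp, apply_ite, this]

theorem basisOp_conj_apply_of_involutive {α : Type} [Fintype α] [DecidableEq α] {v : α → α}
    (hv : Function.Involutive v) (A : Op α) (x y : α) :
    (basisOp v * A * (basisOp v)ᴴ) x y = A (v x) (v y) :=
  basisOp_conj_apply hv.toPerm A x y

/-- The simultaneous relabelling of the basis vectors of three systems. -/
def permThree {d : ℕ} (π : Equiv.Perm (Fin d)) : Equiv.Perm (Three d) :=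
  π.prodCongr (π.prodCongr π)

theorem permOp3_eq {d : ℕ} (π : Equiv.Perm (Fin d)) : permOp3 π = basisOp (permThree π) := by
  ext ⟨i, a, b⟩ ⟨i', a', b'⟩
  simp only [permOp3, basisOp, permThree, kroneckerMap_apply, of_apply, Equiv.prodCongr_apply,
    Prod.map, Prod.mk.injEq]
  by_cases h1 : i = π i' <;> by_cases h2 : a = π a' <;> by_cases h3 : b = π b' <;>
    simp [h1, h2, h3]

/-! ### Characters of the group of angles -/

instance isProbabilityMeasure_haarAngles (d : ℕ) : MeasureTheory.IsProbabilityMeasure (haarAngles d) :=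
  ⟨by simpa [haarAngles] using
    MeasureTheory.Measure.addHaarMeasure_self (K₀ := (⊤ : TopologicalSpace.PositiveCompacts (Angles d)))⟩

instance isAddLeftInvariant_haarAngles (d : ℕ) : (haarAngles d).IsAddLeftInvariant := by
  unfold haarAngles
  infer_instance

theorem expI_add (s t : AddCircle (2 * Real.pi)) : expI (s + t) = expI s * expI t := by
  simp [expI, AddCircle.toCircle_add]

theorem expI_mul_star (t : AddCircle (2 * Real.pi)) : expI t * star (expI t) = 1 := by
  rw [← expI_neg, ← expI_add]
  simp [expI]

theorem continuous_expI : Continuous expI :=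
  continuous_subtype_val.comp AddCircle.continuous_toCircle

/-- The character `θ ↦ exp (i ∑ₖ nₖ θₖ)`. -/
noncomputable def angleChar {d : ℕ} (n : Fin d → ℤ) (θ : Angles d) : ℂ :=
  expI (∑ k, n k • θ k)

theorem continuous_angleChar {d : ℕ} (n : Fin d → ℤ) : Continuous (angleChar n) :=
  continuous_expI.comp (by fun_prop)

theorem angleChar_add {d : ℕ} (n : Fin d → ℤ) (s t : Angles d) :
    angleChar n (s + t) = angleChar n s * angleChar n t := by
  simp [angleChar, smul_add, Finset.sum_add_distrib, expI_add]

theorem angleChar_mul_neg {d : ℕ} (m n : Fin d → ℤ) (θ : Angles d) :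
    angleChar m θ * angleChar n (-θ) = angleChar (m - n) θ := by
  simp [angleChar, ← expI_add, sub_smul, ← sub_eq_add_neg]

theorem angleChar_neg {d : ℕ} (n : Fin d → ℤ) (θ : Angles d) :
    angleChar n (-θ) = star (angleChar n θ) := by
  simp [angleChar, ← expI_neg]

theorem integral_angleChar {d : ℕ} (n : Fin d → ℤ) :
    ∫ θ, angleChar n θ ∂(haarAngles d) = if n = 0 then 1 else 0 := by
  split_ifs with hn
  · subst hn
    simp [angleChar, expI]
  · obtain ⟨k, hk⟩ := Function.ne_iff.1 hn
    have hk' : ((n k : ℤ) : ℝ) ≠ 0 := by exact_mod_cast hk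
    -- The character takes the value `e^{iπ} = -1` at this `t`, so translation invariance makes the
    -- integral equal to its own negative.
    let t : Angles d := Pi.single k ((Real.pi / n k : ℝ) : AddCircle (2 * Real.pi))
    have ht : angleChar n t = -1 := by
      have : ∑ j, n j • t j = ((Real.pi : ℝ) : AddCircle (2 * Real.pi)) := by
        rw [Finset.sum_eq_single k (fun j _ hj => by simp [t, hj]) (by simp)]
        simp only [t, Pi.single_eq_same]
        rw [← AddCircle.coe_zsmul, zsmul_eq_mul, mul_div_cancel₀ _ hk']
      rw [angleChar, this, expI_coe, Complex.exp_pi_mul_I]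
    have h := MeasureTheory.integral_add_left_eq_self (μ := haarAngles d) (angleChar n) t
    simp only [angleChar_add, ht, neg_mul, one_mul, MeasureTheory.integral_neg] at h
    exact self_eq_neg.1 h.symm

theorem integrable_angleChar {d : ℕ} (n : Fin d → ℤ) :
    MeasureTheory.Integrable (angleChar n) (haarAngles d) :=
  (continuous_angleChar n).integrable_of_hasCompactSupport (HasCompactSupport.of_compactSpace _)

theorem twirl_diagonal_apply {d : ℕ} (w : Three d → Fin d → ℤ) (X : Op (Three d))
    (x y : Three d) :
    twirl (fun θ => diagonal fun z => angleChar (w z) θ) X x y =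
      if w x = w y then X x y else 0 := by
  have : ∀ θ : Angles d, angleChar (w x) θ * X x y * angleChar (w y) (-θ) =
      angleChar (w x - w y) θ * X x y := fun θ => by
    rw [mul_right_comm, angleChar_mul_neg]
  simp only [twirl, of_apply, mul_diagonal, diagonal_mul, this]
  rw [MeasureTheory.integral_mul_const, integral_angleChar]
  simp [sub_eq_zero]

/-! ### Positive semidefinite matrices on blocks of equal weight -/

theorem Matrix.PosSemidef.re_add_re_le {X : Type} [Fintype X] [DecidableEq X] {J : Op X}
    (hJ : J.PosSemidef) (x y : X) : (J x y).re + (J y x).re ≤ (J x x).re + (J y y).re := by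
  have h := (Complex.le_def.1 (hJ.dotProduct_mulVec_nonneg (Pi.single x 1 - Pi.single y 1))).1
  simp [mulVec_sub, sub_dotProduct, dotProduct_sub] at h
  linarith

/-- Equality says that the quadratic form vanishes at `e_x - e_y`; for a positive semidefinite
matrix this vector then lies in the kernel, so columns `x` and `y` coincide. -/
theorem Matrix.PosSemidef.apply_eq_of_re {X : Type} [Fintype X] [DecidableEq X] {J : Op X}
    (hJ : J.PosSemidef) {x y : X}
    (h : (J x y).re + (J y x).re = (J x x).re + (J y y).re) (z : X) : J z x = J z y := by
  set v : X → ℂ := Pi.single x 1 - Pi.single y 1 with hv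
  have h0 : star v ⬝ᵥ (J *ᵥ v) = 0 := by
    have h1 := Complex.le_def.1 (hJ.dotProduct_mulVec_nonneg v)
    apply Complex.ext
    · simp [hv, mulVec_sub, sub_dotProduct, dotProduct_sub]
      linarith
    · simpa using h1.2.symm
  have h2 := congrFun ((hJ.dotProduct_mulVec_zero_iff v).1 h0) z
  simpa [hv, mulVec_sub, sub_eq_zero] using h2

theorem Matrix.PosSemidef.re_diag_nonneg {X : Type} [Fintype X] [DecidableEq X] {J : Op X}
    (hJ : J.PosSemidef) (x : X) : 0 ≤ (J x x).re :=
  (Complex.le_def.1 (hJ.diag_nonneg (i := x))).1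

/-- The number of labels of the same weight as `x`. -/
def fiberCard {X Z : Type} [Fintype X] [DecidableEq Z] (w : X → Z) (x : X) : ℕ :=
  (Finset.univ.filter fun y => w x = w y).card

/-- The gap to the bound, split into a pair term and a diagonal term. For positive semidefinite `J`
and `M` bounding the fiber sizes, every summand is nonnegative, which gives both the inequality and
its equality case. -/
theorem sum_fiber_re {X Z : Type} [Fintype X] [DecidableEq Z] (w : X → Z) (J : Op X) (M : ℕ) :
    M * (J.trace).re - ∑ x, ∑ y, (if w x = w y then (J x y).re else 0) =
      (∑ x, ∑ y, if w x = w y then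
        ((J x x).re + (J y y).re - (J x y).re - (J y x).re) / 2 else 0) +
      ∑ x, ((M : ℝ) - fiberCard w x) * (J x x).re := by
  have h1 : ∑ x, ∑ y, (if w x = w y then (J y y).re else 0) =
      ∑ x, ∑ y, (if w x = w y then (J x x).re else 0) := by
    rw [Finset.sum_comm]
    simp only [eq_comm]
  have h2 : ∑ x, ∑ y, (if w x = w y then (J y x).re else 0) =
      ∑ x, ∑ y, (if w x = w y then (J x y).re else 0) := by
    rw [Finset.sum_comm]
    simp only [eq_comm]
  have h3 : ∑ x, ∑ y, (if w x = w y then (J x x).re else 0) =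
      ∑ x, (fiberCard w x : ℝ) * (J x x).re := by
    refine Finset.sum_congr rfl fun x _ => ?_
    rw [← Finset.sum_filter, Finset.sum_const, nsmul_eq_mul, fiberCard]
  have h4 : (∑ x, ∑ y, if w x = w y then
        ((J x x).re + (J y y).re - (J x y).re - (J y x).re) / 2 else 0) =
      (∑ x, ∑ y, (if w x = w y then (J x x).re else 0) +
        ∑ x, ∑ y, (if w x = w y then (J y y).re else 0) -
        ∑ x, ∑ y, (if w x = w y then (J x y).re else 0) -
        ∑ x, ∑ y, (if w x = w y then (J y x).re else 0)) / 2 := by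
    simp only [← Finset.sum_add_distrib, ← Finset.sum_sub_distrib, Finset.sum_div]
    refine Finset.sum_congr rfl fun x _ => Finset.sum_congr rfl fun y _ => ?_
    split_ifs <;> simp
  rw [h4, h1, h2, h3]
  simp only [sub_mul, Finset.sum_sub_distrib, ← Finset.mul_sum, Matrix.trace, diag_apply,
    Complex.re_sum]
  ring

theorem Matrix.PosSemidef.sum_fiber_re_le {X Z : Type} [Fintype X] [DecidableEq X]
    [DecidableEq Z] {w : X → Z} {J : Op X} {M : ℕ} (hJ : J.PosSemidef)
    (hM : ∀ x, fiberCard w x ≤ M) :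
    ∑ x, ∑ y, (if w x = w y then (J x y).re else 0) ≤ M * (J.trace).re := by
  rw [← sub_nonneg, sum_fiber_re]
  refine add_nonneg (Finset.sum_nonneg fun x _ => Finset.sum_nonneg fun y _ => ?_)
    (Finset.sum_nonneg fun x _ => ?_)
  · split_ifs
    · linarith [hJ.re_add_re_le x y]
    · rfl
  · have : (fiberCard w x : ℝ) ≤ M := by exact_mod_cast hM x
    exact mul_nonneg (by linarith) (hJ.re_diag_nonneg x)

theorem Matrix.PosSemidef.eq_of_sum_fiber_re {X Z : Type} [Fintype X] [DecidableEq X]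
    [DecidableEq Z] {w : X → Z} {J : Op X} {M : ℕ} (hJ : J.PosSemidef)
    (hM : ∀ x, fiberCard w x ≤ M)
    (h : ∑ x, ∑ y, (if w x = w y then (J x y).re else 0) = M * (J.trace).re) :
    (∀ x y, w x = w y → J x y = J x x ∧ J y y = J x x) ∧
      ∀ x, fiberCard w x < M → J x x = 0 := by
  have h0 := sum_fiber_re w J M
  rw [h, sub_self] at h0
  have hpair : ∀ x y, 0 ≤ (if w x = w y then
      ((J x x).re + (J y y).re - (J x y).re - (J y x).re) / 2 else 0) := fun x y => by
    split_ifs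
    · linarith [hJ.re_add_re_le x y]
    · rfl
  have hdiag : ∀ x, 0 ≤ ((M : ℝ) - fiberCard w x) * (J x x).re := fun x => by
    have : (fiberCard w x : ℝ) ≤ M := by exact_mod_cast hM x
    exact mul_nonneg (by linarith) (hJ.re_diag_nonneg x)
  obtain ⟨h1, h2⟩ := (add_eq_zero_iff_of_nonneg
    (Finset.sum_nonneg fun x _ => Finset.sum_nonneg fun y _ => hpair x y)
    (Finset.sum_nonneg fun x _ => hdiag x)).1 h0.symm
  refine ⟨fun x y hxy => ?_, fun x hx => ?_⟩
  · have h3 := (Finset.sum_eq_zero_iff_of_nonneg fun x _ =>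
      Finset.sum_nonneg fun y _ => hpair x y).1 h1 x (Finset.mem_univ x)
    have h4 := (Finset.sum_eq_zero_iff_of_nonneg fun y _ => hpair x y).1 h3 y (Finset.mem_univ y)
    rw [if_pos hxy] at h4
    have h5 := hJ.apply_eq_of_re (x := x) (y := y) (by linarith)
    refine ⟨(h5 x).symm, ?_⟩
    have hx : J x y = J x x := (h5 x).symm
    have hy : J y x = J y y := h5 y
    rw [← hy, ← hJ.isHermitian.apply y x, hx, hJ.isHermitian.apply x x]
  · have h3 := (Finset.sum_eq_zero_iff_of_nonneg fun x _ => hdiag x).1 h2 x (Finset.mem_univ x)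
    have : (fiberCard w x : ℝ) < M := by exact_mod_cast hx
    have h4 := (mul_eq_zero.1 h3).resolve_left (by linarith)
    refine Complex.ext h4 ?_
    simpa using (Complex.le_def.1 (hJ.diag_nonneg (i := x))).2.symm

/-! ### Process fidelity as a sum over the Choi operator -/

/-- The weight `eᵢ - s eₐ - t e_b` of the basis label `(i, a, b)`. -/
def phaseWeight {d : ℕ} (s t : ℤ) (x : Three d) : Fin d → ℤ :=
  Pi.single x.1 1 - s • Pi.single x.2.1 1 - t • Pi.single x.2.2 1

theorem angleChar_phaseWeight {d : ℕ} (s t : ℤ) (x : Three d) (θ : Angles d) :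
    angleChar (phaseWeight s t x) θ =
      expI (θ x.1) * (expI (-(s • θ) x.2.1) * expI (-(t • θ) x.2.2)) := by
  rw [← expI_add, ← expI_add, angleChar]
  congr 1
  simp [phaseWeight, sub_smul, Finset.sum_sub_distrib, Pi.single_apply]
  abel

theorem phaseOp_kronecker {d : ℕ} (s t : ℤ) (θ : Angles d) :
    phaseOp θ ⊗ₖ (phaseOp (-(s • θ)) ⊗ₖ phaseOp (-(t • θ))) =
      diagonal fun z => angleChar (phaseWeight s t z) θ := by
  simp only [phaseOp, diagonal_kronecker_diagonal, angleChar_phaseWeight, Pi.neg_apply]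

theorem star_phaseKet_dotProduct {d : ℕ} (hd : 1 ≤ d) (θ : Angles d) :
    star (phaseKet θ) ⬝ᵥ phaseKet θ = 1 := by
  have hd' : (0 : ℝ) < d := by exact_mod_cast hd
  have h : ∀ k, star (phaseKet θ k) * phaseKet θ k = ((1 / d : ℝ) : ℂ) := fun k => by
    simp only [phaseKet, star_mul', RCLike.star_def, Complex.conj_ofReal]
    rw [mul_mul_mul_comm, ← Complex.ofReal_mul, mul_comm (starRingEnd ℂ _), ← RCLike.star_def,
      expI_mul_star, mul_one]
    rw [div_mul_div_comm, one_mul, Real.mul_self_sqrt hd'.le]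
  simp only [dotProduct, Pi.star_apply, h]
  simp
  field_simp

/-- The product vector `|sθ⟩ ⊗ |tθ⟩`. -/
noncomputable def phaseKetTwo {d : ℕ} (s t : ℤ) (θ : Angles d) (p : Two d) : ℂ :=
  phaseKet (s • θ) p.1 * phaseKet (t • θ) p.2

theorem phaseState_kronecker {d : ℕ} (s t : ℤ) (θ : Angles d) :
    phaseState (s • θ) ⊗ₖ phaseState (t • θ) =
      vecMulVec (phaseKetTwo s t θ) (star (phaseKetTwo s t θ)) := by
  ext p q
  simp only [phaseState, kroneckerMap_apply, vecMulVec_apply, phaseKetTwo, Pi.star_apply, star_mul']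
  ring

theorem star_phaseKetTwo_dotProduct {d : ℕ} (hd : 1 ≤ d) (s t : ℤ) (θ : Angles d) :
    star (phaseKetTwo s t θ) ⬝ᵥ phaseKetTwo s t θ = 1 := by
  have h1 := star_phaseKet_dotProduct hd (s • θ)
  have h2 := star_phaseKet_dotProduct hd (t • θ)
  simp only [dotProduct, Pi.star_apply] at h1 h2 ⊢
  rw [← one_mul (1 : ℂ)]
  nth_rewrite 1 [← h1]
  rw [← h2, Finset.sum_mul_sum, Fintype.sum_prod_type]
  refine Finset.sum_congr rfl fun a _ => Finset.sum_congr rfl fun b _ => ?_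
  simp only [phaseKetTwo, star_mul']
  ring

theorem phaseKet_mul_star_phaseKetTwo {d : ℕ} (s t : ℤ) (θ : Angles d) (x : Three d) :
    phaseKet θ x.1 * star (phaseKetTwo s t θ x.2) =
      ((1 / Real.sqrt d : ℝ) : ℂ) ^ 3 * angleChar (phaseWeight s t x) θ := by
  simp only [angleChar_phaseWeight, phaseKetTwo, phaseKet, star_mul', ← expI_neg]
  simp only [RCLike.star_def, Complex.conj_ofReal]
  ring

/-- The input amplitude and the two conjugated output amplitudes of a label multiply to `d^{-3/2}`
times one character; rows and columns together give `d⁻³`. -/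
theorem expectation_phaseKetTwo {d : ℕ} (hd : 1 ≤ d) (s t : ℤ) (θ : Angles d)
    (E : Op (Fin d) →ₗ[ℂ] Op (Two d)) :
    star (phaseKetTwo s t θ) ⬝ᵥ (E (phaseState θ) *ᵥ phaseKetTwo s t θ) =
      ((1 / (d : ℝ) ^ 3 : ℝ) : ℂ) * ∑ x, ∑ y,
        angleChar (phaseWeight s t x - phaseWeight s t y) θ * choi E x y := by
  have hd' : (0 : ℝ) < d := by exact_mod_cast hd
  have hc : (((1 / Real.sqrt d : ℝ) : ℂ) ^ 3) * (((1 / Real.sqrt d : ℝ) : ℂ) ^ 3) =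
      ((1 / (d : ℝ) ^ 3 : ℝ) : ℂ) := by
    rw [← mul_pow, ← Complex.ofReal_mul, div_mul_div_comm, one_mul, Real.mul_self_sqrt hd'.le,
      ← Complex.ofReal_pow, div_pow, one_pow]
  have hterm : ∀ x y : Three d, ((1 / (d : ℝ) ^ 3 : ℝ) : ℂ) *
      (angleChar (phaseWeight s t x - phaseWeight s t y) θ * choi E x y) =
      star (phaseKetTwo s t θ x.2) * (phaseState θ x.1 y.1 * choi E x y) *
        phaseKetTwo s t θ y.2 := fun x y => by
    have hx := phaseKet_mul_star_phaseKetTwo s t θ x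
    have hy := congrArg star (phaseKet_mul_star_phaseKetTwo s t θ y)
    rw [← angleChar_mul_neg, angleChar_neg, ← hc]
    simp only [star_mul', star_pow, RCLike.star_def, starRingEnd_self_apply,
      Complex.conj_ofReal] at hx hy ⊢
    simp only [phaseState, vecMulVec_apply, Pi.star_apply, RCLike.star_def]
    linear_combination (-(choi E x y) * ((starRingEnd ℂ) (phaseKet θ y.1) *
      phaseKetTwo s t θ y.2)) * hx - (choi E x y * (((1 / Real.sqrt d : ℝ) : ℂ) ^ 3 *
        angleChar (phaseWeight s t x) θ)) * hy
  simp only [Finset.mul_sum, hterm]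
  simp only [dotProduct, mulVec, Pi.star_apply, apply_eq_sum_choi E (phaseState θ),
    Fintype.sum_prod_type (α₁ := Fin d) (α₂ := Two d), Finset.mul_sum, Finset.sum_mul]
  rw [Finset.sum_comm' (t' := Finset.univ) (s' := fun _ => Finset.univ) (by simp)]
  conv_rhs => rw [Finset.sum_comm]
  rw [Finset.sum_comm]
  refine Finset.sum_congr rfl fun p _ => ?_
  rw [Finset.sum_comm]
  conv_rhs => rw [Finset.sum_congr rfl fun i _ => Finset.sum_comm, Finset.sum_comm]
  rw [Finset.sum_comm]
  refine Finset.sum_congr rfl fun q _ => Finset.sum_congr rfl fun i _ =>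
    Finset.sum_congr rfl fun j _ => ?_
  ring

theorem processFidelity_eq_sum {d : ℕ} (hd : 1 ≤ d) (s t : ℤ) {Eid : Op (Fin d) → Op (Two d)}
    (hid : ∀ θ : Angles d, Eid (phaseState θ) = phaseState (s • θ) ⊗ₖ phaseState (t • θ))
    {E : Op (Fin d) →ₗ[ℂ] Op (Two d)} (hE : IsChannel E) :
    processFidelity Eid E = 1 / (d : ℝ) ^ 3 *
      ∑ x, ∑ y, if phaseWeight s t x = phaseWeight s t y then (choi E x y).re else 0 := by
  have hpt : ∀ θ : Angles d, fidelity (Eid (phaseState θ)) (E (phaseState θ)) =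
      (((1 / (d : ℝ) ^ 3 : ℝ) : ℂ) * ∑ x, ∑ y,
        angleChar (phaseWeight s t x - phaseWeight s t y) θ * choi E x y).re := fun θ => by
    rw [hid, phaseState_kronecker, fidelity_pure (star_phaseKetTwo_dotProduct hd s t θ)
      (hE.posSemidef (X := phaseState θ) (posSemidef_vecMulVec_self_star _)),
      expectation_phaseKetTwo hd]
  have hint : ∀ x y : Three d, MeasureTheory.Integrable (fun θ =>
      angleChar (phaseWeight s t x - phaseWeight s t y) θ * choi E x y) (haarAngles d) :=
    fun x y => (integrable_angleChar _).mul_const _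
  have hI : MeasureTheory.Integrable (fun θ => ((1 / (d : ℝ) ^ 3 : ℝ) : ℂ) * ∑ x, ∑ y,
      angleChar (phaseWeight s t x - phaseWeight s t y) θ * choi E x y) (haarAngles d) :=
    (MeasureTheory.integrable_finsetSum _ fun x _ => MeasureTheory.integrable_finsetSum _ fun y _ => hint x y).const_mul _
  simp only [processFidelity, hpt]
  have hre := integral_re hI
  simp only [RCLike.re_eq_complex_re] at hre
  rw [hre, MeasureTheory.integral_const_mul, MeasureTheory.integral_finsetSum _
    fun x _ => MeasureTheory.integrable_finsetSum _ fun y _ => hint x y]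
  simp_rw [MeasureTheory.integral_finsetSum _ fun y _ => hint _ y, MeasureTheory.integral_mul_const, integral_angleChar,
    sub_eq_zero]
  rw [Complex.re_ofReal_mul, Complex.re_sum]
  simp only [Complex.re_sum, ite_mul, one_mul, zero_mul, apply_ite Complex.re, Complex.zero_re]

/-! ### Optimal Choi operators -/

/-- The combinatorics of a weight function that determines the optimal Choi operators:
`H` singles out the labels whose weight is attained most often. -/
structure IsCloningWeight {d : ℕ} (w : Three d → Fin d → ℤ) (H : Three d → Prop)
    [DecidablePred H] : Prop where
  perm : ∀ π x y, w x = w y → w (permThree π x) = w (permThree π y)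
  heavy_perm : ∀ π x, H (permThree π x) ↔ H x
  card_of_heavy : ∀ x, H x → fiberCard w x = 2 * d - 1
  card_of_not_heavy : ∀ x, ¬ H x → fiberCard w x < 2 * d - 1
  exists_perm : ∀ x y, H x → H y → ∃ π, w (permThree π x) = w y
  card_input : ∀ i, (Finset.univ.filter fun p => H (i, p)).card = 2 * d - 1
  input_injective : ∀ i j p, w (i, p) = w (j, p) → i = j

namespace IsCloningWeight

variable {d : ℕ} {w : Three d → Fin d → ℤ} {H : Three d → Prop} [DecidablePred H]

theorem card_le (h : IsCloningWeight w H) (x : Three d) : fiberCard w x ≤ 2 * d - 1 := by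
  by_cases hx : H x
  · exact (h.card_of_heavy x hx).le
  · exact (h.card_of_not_heavy x hx).le

theorem heavy_congr (h : IsCloningWeight w H) {x y : Three d} (hxy : w x = w y) (hx : H x) :
    H y := by
  by_contra hy
  have h1 := h.card_of_heavy x hx
  have h2 := h.card_of_not_heavy y hy
  simp only [fiberCard, hxy] at h1 h2
  omega

theorem card_heavy (h : IsCloningWeight w H) :
    (Finset.univ.filter H).card = d * (2 * d - 1) := by
  rw [Finset.card_filter, Fintype.sum_prod_type (α₁ := Fin d) (α₂ := Two d)]
  simp only [← Finset.card_filter, h.card_input]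
  simp

end IsCloningWeight

theorem sum_ite_fiber {X Z R : Type} [Fintype X] [DecidableEq Z] [Semiring R] (w : X → Z)
    (x : X) (c : R) : ∑ y, (if w x = w y then c else 0) = fiberCard w x * c := by
  rw [← Finset.sum_filter, Finset.sum_const, nsmul_eq_mul, fiberCard]

/-- The averaged Choi operator of the optimal channels. -/
noncomputable def optimalChoi {d : ℕ} (w : Three d → Fin d → ℤ) (H : Three d → Prop)
    [DecidablePred H] : Op (Three d) :=
  Matrix.of fun x y => if w x = w y ∧ H x then (1 / (2 * d - 1 : ℕ) : ℂ) else 0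

/-- On each heavy fiber the operator is the projection onto the all-ones vector, so it equals `Bᴴ *
B` with `B` the operator itself. Trace preservation is `card_input` on the diagonal and
`input_injective` off it. -/
theorem IsCloningWeight.isChannel_ofChoi {d : ℕ} {w : Three d → Fin d → ℤ} {H : Three d → Prop}
    [DecidablePred H] (h : IsCloningWeight w H) (hd : 1 ≤ d) :
    IsChannel (ofChoi (optimalChoi w H)) := by
  have hM : ((2 * d - 1 : ℕ) : ℂ) ≠ 0 := by
    rw [Nat.cast_ne_zero]
    omega
  let B : Op (Three d) := optimalChoi w H
  refine _root_.isChannel_ofChoi (B := B) ?_ fun i j => ?_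
  · ext x y
    have hterm : ∀ z, star (B z x) * B z y = if w x = w z then
        (if w x = w y ∧ H x then (1 / (2 * d - 1 : ℕ) * (1 / (2 * d - 1 : ℕ)) : ℂ) else 0)
          else 0 := fun z => by
      have h1 : w x = w z → (H z ↔ H x) := fun hz =>
        ⟨h.heavy_congr hz.symm, h.heavy_congr hz⟩
      simp only [B, optimalChoi, of_apply]
      by_cases hz : w x = w z
      · rw [← hz]
        simp only [h1 hz]
        by_cases hx : H x <;> by_cases hy : w x = w y <;> simp [hx, hy]
      · simp [hz, Ne.symm hz]
    simp only [mul_apply, conjTranspose_apply, hterm, sum_ite_fiber]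
    simp only [optimalChoi, of_apply]
    split_ifs with hxy
    · rw [h.card_of_heavy x hxy.2]
      field_simp
    · simp
  · split_ifs with hij
    · subst hij
      simp only [optimalChoi, of_apply, true_and, ← Finset.sum_filter, Finset.sum_const,
        h.card_input, nsmul_eq_mul]
      field_simp
    · refine Finset.sum_eq_zero fun p _ => if_neg fun hp => hij (h.input_injective i j p hp.1)

theorem IsCloningWeight.sum_optimalChoi {d : ℕ} {w : Three d → Fin d → ℤ} {H : Three d → Prop}
    [DecidablePred H] (h : IsCloningWeight w H) (hd : 1 ≤ d) :
    ∑ x, ∑ y, (if w x = w y then (optimalChoi w H x y).re else 0) = d * (2 * d - 1 : ℕ) := by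
  have hM : ((2 * d - 1 : ℕ) : ℝ) ≠ 0 := by
    rw [Nat.cast_ne_zero]
    omega
  have hx : ∀ x, ∑ y, (if w x = w y then (optimalChoi w H x y).re else 0) =
      if H x then (1 : ℝ) else 0 := fun x => by
    have hterm : ∀ y, (if w x = w y then (optimalChoi w H x y).re else 0) =
        if w x = w y then (if H x then (1 / (2 * d - 1 : ℕ) : ℝ) else 0) else 0 := fun y => by
      by_cases hxy : w x = w y <;> by_cases hx : H x <;> simp [optimalChoi, hxy, hx]
    simp only [hterm, sum_ite_fiber]
    split_ifs with hx
    · rw [h.card_of_heavy x hx]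
      field_simp
    · simp
  simp only [hx, ← Finset.sum_filter, Finset.sum_const, h.card_heavy]
  simp

/-- By transitivity the sum over permutations is the same at all `d (2d - 1)` heavy labels and zero
elsewhere; its total over all labels is `d! * d`. -/
theorem IsCloningWeight.sum_perm_diag {d : ℕ} {w : Three d → Fin d → ℤ} {H : Three d → Prop}
    [DecidablePred H] (h : IsCloningWeight w H) (hd : 1 ≤ d) {c : Three d → ℂ}
    (hc : ∀ x y, w x = w y → c y = c x) (hc0 : ∀ x, ¬ H x → c x = 0)
    (hsum : ∑ x, c x = d) (x : Three d) :
    ∑ π, c (permThree π x) = if H x then (d.factorial : ℂ) / (2 * d - 1 : ℕ) else 0 := by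
  have hM : ((2 * d - 1 : ℕ) : ℂ) ≠ 0 := by
    rw [Nat.cast_ne_zero]
    omega
  have hd0 : (d : ℂ) ≠ 0 := by
    rw [Nat.cast_ne_zero]
    omega
  have h0 : ∀ y, ¬ H y → ∑ π, c (permThree π y) = 0 := fun y hy =>
    Finset.sum_eq_zero fun π _ => hc0 _ (mt (h.heavy_perm π y).1 hy)
  split_ifs with hx
  · have hconst : ∀ y, H y → ∑ π, c (permThree π y) = ∑ π, c (permThree π x) := fun y hy => by
      obtain ⟨ρ, hρ⟩ := h.exists_perm x y hx hy
      rw [← Equiv.sum_comp (Equiv.mulRight ρ) fun π => c (permThree π x)]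
      exact Finset.sum_congr rfl fun π _ => hc _ _ (h.perm π _ _ hρ)
    have htotal : ∑ y, ∑ π, c (permThree π y) = d.factorial * d := by
      rw [Finset.sum_comm]
      simp only [Equiv.sum_comp (permThree _) c, hsum]
      simp [Fintype.card_perm]
    have htotal' : ∑ y, ∑ π, c (permThree π y) =
        (d * (2 * d - 1) : ℕ) * ∑ π, c (permThree π x) := by
      rw [← h.card_heavy, ← nsmul_eq_mul, ← Finset.sum_const, Finset.sum_filter]
      refine Finset.sum_congr rfl fun y _ => ?_
      split_ifs with hy
      · exact hconst y hy
      · exact h0 y hy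
    rw [htotal, Nat.cast_mul] at htotal'
    rw [eq_div_iff hM]
    exact mul_left_cancel₀ hd0 (by linear_combination -htotal')
  · exact h0 x hx

theorem IsCloningWeight.average_eq {d : ℕ} {w : Three d → Fin d → ℤ} {H : Three d → Prop}
    [DecidablePred H] (h : IsCloningWeight w H) (hd : 1 ≤ d) {v : Three d → Three d}
    (hv : Function.Involutive v) (hvw : ∀ x, w (v x) = w x) {J : Op (Three d)}
    (hJ : J.PosSemidef) (htr : J.trace = d)
    (hopt : ∑ x, ∑ y, (if w x = w y then (J x y).re else 0) = d * (2 * d - 1 : ℕ)) :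
    average (fun θ => diagonal fun z => angleChar (w z) θ) (basisOp v) J = optimalChoi w H := by
  obtain ⟨hcl, hzero⟩ := hJ.eq_of_sum_fiber_re h.card_le
    (by rw [hopt, htr, mul_comm, Complex.natCast_re])
  have hdiag := h.sum_perm_diag hd (c := fun x => J x x) (fun x y hxy => (hcl x y hxy).2)
    (fun x hx => hzero x (h.card_of_not_heavy x hx)) htr
  have hperm : ∀ π x y, w ((permThree π).symm x) = w ((permThree π).symm y) ↔ w x = w y :=
    fun π x y => ⟨fun e => by simpa using h.perm π _ _ e, fun e => h.perm π⁻¹ x y e⟩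
  ext x y
  -- Since `v` preserves weights and an optimal `J` is constant on fiber blocks, the term conjugated
  -- by `basisOp v` repeats the first one, whence the factor `2`.
  have hterm : ∀ π : Equiv.Perm (Fin d),
      (permOp3 π * twirl (fun θ => diagonal fun z => angleChar (w z) θ) J * (permOp3 π)ᴴ +
        basisOp v * (permOp3 π * twirl (fun θ => diagonal fun z => angleChar (w z) θ) J *
          (permOp3 π)ᴴ) * (basisOp v)ᴴ) x y =
      if w x = w y then 2 * J (permThree π⁻¹ x) (permThree π⁻¹ x) else 0 := fun π => by
    rw [Matrix.add_apply, basisOp_conj_apply_of_involutive hv, permOp3_eq, basisOp_conj_apply,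
      basisOp_conj_apply, twirl_diagonal_apply, twirl_diagonal_apply]
    simp only [hperm, hvw]
    split_ifs with hxy
    · rw [(hcl _ _ ((hperm π x y).2 hxy)).1,
        (hcl _ _ ((hperm π (v x) (v y)).2 (by rw [hvw, hvw, hxy]))).1,
        (hcl _ _ ((hperm π x (v x)).2 (hvw x).symm)).2, two_mul]
      rfl
    · simp
  have hfact : (d.factorial : ℂ) ≠ 0 := by exact_mod_cast d.factorial_ne_zero
  simp only [average, Matrix.smul_apply, Matrix.sum_apply, hterm, optimalChoi, of_apply,
    smul_eq_mul]
  by_cases hxy : w x = w y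
  · simp only [hxy, if_true, true_and, ← Finset.mul_sum]
    have hinv : ∑ π : Equiv.Perm (Fin d), J (permThree π⁻¹ x) (permThree π⁻¹ x) =
        ∑ π : Equiv.Perm (Fin d), J (permThree π x) (permThree π x) :=
      Equiv.sum_comp (Equiv.inv _) fun π => J (permThree π x) (permThree π x)
    rw [hinv, hdiag]
    split_ifs
    · field_simp
    · simp
  · simp [hxy]

/-! ### The weights of the cloner and of the hybrid maps -/

theorem phaseWeight_permThree {d : ℕ} (s t : ℤ) (π : Equiv.Perm (Fin d)) (x : Three d) :
    phaseWeight s t (permThree π x) = phaseWeight s t x ∘ π.symm := by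
  ext k
  simp [phaseWeight, permThree, Pi.single_apply, Equiv.symm_apply_eq]

theorem phaseWeight_cloner_apply {d : ℕ} (i a b k : Fin d) :
    phaseWeight 1 1 (i, a, b) k =
      (if k = i then 1 else 0) - (if k = a then 1 else 0) - (if k = b then 1 else 0) := by
  simp [phaseWeight, Pi.single_apply]

/-- Labels `(i, a, b)` in which the input agrees with one of the outputs. -/
def inputCopied {d : ℕ} (x : Three d) : Prop := x.1 = x.2.1 ∨ x.1 = x.2.2

instance decidablePred_inputCopied {d : ℕ} : DecidablePred (inputCopied (d := d)) :=
  fun _ => inferInstanceAs (Decidable (_ ∨ _))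

/-- With `y = (j, a, c)`, the equation `e_j + e_b = e_a + e_c` means that the multisets `{j, b}` and
`{a, c}` agree. -/
theorem phaseWeight_eq_neg_single_iff {d : ℕ} (b : Fin d) (y : Three d) :
    phaseWeight 1 1 y = -Pi.single b 1 ↔ y.2 = (y.1, b) ∨ y.2 = (b, y.1) := by
  obtain ⟨j, a, c⟩ := y
  constructor
  · intro h
    have h1 := congrFun h j
    have h2 := congrFun h a
    have h3 := congrFun h b
    simp only [phaseWeight_cloner_apply, Pi.neg_apply, Pi.single_apply] at h1 h2 h3
    simp only [Prod.mk.injEq]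
    grind
  · rintro (h | h) <;> simp only [Prod.mk.injEq] at h <;> obtain ⟨rfl, rfl⟩ := h <;> ext k <;>
      simp only [phaseWeight_cloner_apply, Pi.neg_apply, Pi.single_apply] <;> ring

theorem phaseWeight_of_inputCopied {d : ℕ} {x : Three d} (hx : inputCopied x) :
    ∃ b, phaseWeight 1 1 x = -Pi.single b 1 := by
  obtain ⟨i, a, b⟩ := x
  rcases hx with h | h <;> simp only at h <;> subst h
  · exact ⟨b, (phaseWeight_eq_neg_single_iff _ _).2 (Or.inl rfl)⟩
  · exact ⟨a, (phaseWeight_eq_neg_single_iff _ _).2 (Or.inr rfl)⟩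

theorem fiberCard_of_inputCopied {d : ℕ} {x : Three d} (hx : inputCopied x) :
    fiberCard (phaseWeight 1 1) x = 2 * d - 1 := by
  obtain ⟨b, hb⟩ := phaseWeight_of_inputCopied hx
  -- The two families `(j, j, b)` and `(j, b, j)` share only `(b, b, b)`, which is erased from the
  -- second: `d + (d - 1)` labels.
  have hset : (Finset.univ.filter fun y : Three d => phaseWeight 1 1 x = phaseWeight 1 1 y) =
      Finset.univ.image (fun j : Fin d => (j, j, b)) ∪
        (Finset.univ.erase b).image (fun j : Fin d => (j, b, j)) := by
    ext ⟨j, a, c⟩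
    rw [Finset.mem_filter, hb, eq_comm (a := -Pi.single b 1), phaseWeight_eq_neg_single_iff]
    simp only [Finset.mem_univ, true_and, Finset.mem_union, Finset.mem_image,
      Finset.mem_erase, Prod.mk.injEq, and_true]
    constructor
    · rintro (⟨rfl, rfl⟩ | ⟨rfl, rfl⟩)
      · exact Or.inl ⟨_, rfl, rfl, rfl⟩
      · by_cases hac : c = a
        · exact Or.inl ⟨c, rfl, hac, hac.symm⟩
        · exact Or.inr ⟨c, hac, rfl, rfl, rfl⟩
    · rintro (⟨k, rfl, rfl, rfl⟩ | ⟨k, -, rfl, rfl, rfl⟩)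
      · exact Or.inl ⟨rfl, rfl⟩
      · exact Or.inr ⟨rfl, rfl⟩
  rw [fiberCard, hset, Finset.card_union_of_disjoint, Finset.card_image_of_injective,
    Finset.card_image_of_injective, Finset.card_erase_of_mem (Finset.mem_univ b)]
  · simp only [Finset.card_univ, Fintype.card_fin]
    have := b.pos
    omega
  · intro j k h
    simpa using h
  · intro j k h
    simpa using h
  · rw [Finset.disjoint_left]
    simp only [Finset.mem_image, Finset.mem_univ, true_and, Finset.mem_erase]
    rintro _ ⟨j, rfl⟩ ⟨k, ⟨hk, -⟩, h⟩
    simp only [Prod.mk.injEq] at h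
    exact hk h.2.2

theorem fiberCard_of_not_inputCopied {d : ℕ} {x : Three d} (hx : ¬ inputCopied x) :
    fiberCard (phaseWeight 1 1) x < 2 * d - 1 := by
  obtain ⟨i, a, b⟩ := x
  simp only [inputCopied, not_or] at hx
  -- Nothing cancels in the weight, so it determines the input and the unordered pair of outputs.
  have hsub : (Finset.univ.filter fun y : Three d =>
      phaseWeight 1 1 (i, a, b) = phaseWeight 1 1 y) ⊆ {(i, a, b), (i, b, a)} := by
    rintro ⟨j, a', b'⟩ hy
    simp only [Finset.mem_filter, Finset.mem_univ, true_and] at hy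
    have h1 := congrFun hy i
    have h2 := congrFun hy a
    have h3 := congrFun hy b
    have h4 := congrFun hy a'
    have h5 := congrFun hy b'
    have h6 := congrFun hy j
    simp only [phaseWeight_cloner_apply] at h1 h2 h3 h4 h5 h6
    simp only [Finset.mem_insert, Finset.mem_singleton, Prod.mk.injEq]
    grind
  have hle := (Finset.card_le_card hsub).trans Finset.card_le_two
  -- A fiber of at most two labels is smaller than `2d - 1` only once `d ≥ 2`, which `i ≠ a`
  -- guarantees.
  have h2 : 1 < d := by
    by_contra hd
    exact hx.1 (Fin.ext (by omega))
  rw [fiberCard]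
  omega

theorem card_filter_eq_or_eq {d : ℕ} (i : Fin d) :
    (Finset.univ.filter fun p : Two d => i = p.1 ∨ i = p.2).card = 2 * d - 1 := by
  -- Counting the complement gives `d² - (d - 1)² = 2d - 1`.
  have hset : (Finset.univ.filter fun p : Two d => i = p.1 ∨ i = p.2) =
      ((Finset.univ.erase i) ×ˢ (Finset.univ.erase i))ᶜ := by
    ext p
    simp only [Finset.mem_filter, Finset.mem_univ, true_and, Finset.mem_compl, Finset.mem_product,
      Finset.mem_erase, and_true]
    grind
  rw [hset, Finset.card_compl, Finset.card_product, Finset.card_erase_of_mem (Finset.mem_univ i)]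
  simp only [Fintype.card_prod, Finset.card_univ, Fintype.card_fin]
  obtain ⟨n, rfl⟩ := Nat.exists_eq_succ_of_ne_zero (by have := i.pos; omega : d ≠ 0)
  simp only [Nat.succ_eq_add_one, Nat.add_sub_cancel]
  rw [Nat.sub_eq_iff_eq_add (by nlinarith)]
  have : 2 * (n + 1) - 1 = 2 * n + 1 := by omega
  rw [this]
  ring

theorem phaseWeight_input_injective {d : ℕ} (s t : ℤ) (i j : Fin d) (p : Two d)
    (h : phaseWeight s t (i, p) = phaseWeight s t (j, p)) : i = j := by
  have := congrFun h i
  simp only [phaseWeight, Pi.sub_apply, Pi.single_apply] at this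
  by_contra hij
  simp [hij] at this

theorem isCloningWeight_cloner (d : ℕ) :
    IsCloningWeight (phaseWeight (d := d) 1 1) inputCopied where
  perm π x y h := by rw [phaseWeight_permThree, phaseWeight_permThree, h]
  heavy_perm π x := by simp [inputCopied, permThree]
  card_of_heavy _ := fiberCard_of_inputCopied
  card_of_not_heavy _ := fiberCard_of_not_inputCopied
  exists_perm x y hx hy := by
    obtain ⟨b, hb⟩ := phaseWeight_of_inputCopied hx
    obtain ⟨c, hc⟩ := phaseWeight_of_inputCopied hy
    refine ⟨Equiv.swap b c, ?_⟩
    rw [phaseWeight_permThree, hb, hc]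
    ext k
    simp [Pi.single_apply, Equiv.swap_apply_eq_iff]
  card_input := card_filter_eq_or_eq
  input_injective := phaseWeight_input_injective 1 1

/-- Fiber sizes and the permutation action pass through `τ`. The two conditions that single out
system 1 do not, because `τ` may move the input, so they remain hypotheses. -/
theorem IsCloningWeight.transport {d : ℕ} {w w' : Three d → Fin d → ℤ} {H : Three d → Prop}
    [DecidablePred H] (h : IsCloningWeight w H) (τ : Equiv.Perm (Three d))
    (hτ : ∀ π x, τ (permThree π x) = permThree π (τ x))
    (hw : ∀ x y, w' x = w' y ↔ w (τ x) = w (τ y))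
    (hcard : ∀ i, (Finset.univ.filter fun p => H (τ (i, p))).card = 2 * d - 1)
    (hinj : ∀ i j p, w' (i, p) = w' (j, p) → i = j) :
    IsCloningWeight w' fun x => H (τ x) := by
  have hfib : ∀ x, fiberCard w' x = fiberCard w (τ x) := fun x =>
    Finset.card_equiv τ fun y => by simp [hw]
  refine ⟨fun π x y hxy => ?_, fun π x => ?_, fun x hx => ?_, fun x hx => ?_, fun x y hx hy => ?_,
    hcard, hinj⟩
  · rw [hw, hτ, hτ]
    exact h.perm π _ _ ((hw x y).1 hxy)
  · rw [hτ, h.heavy_perm]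
  · rw [hfib, h.card_of_heavy _ hx]
  · rw [hfib]
    exact h.card_of_not_heavy _ hx
  · obtain ⟨π, hπ⟩ := h.exists_perm _ _ hx hy
    exact ⟨π, by rw [hw, hτ, hπ]⟩

/-- The exchange of the labels of systems 1 and 2. -/
def swap12 (d : ℕ) (x : Three d) : Three d := (x.2.1, (x.1, x.2.2))

/-- The exchange of the labels of systems 1 and 3. -/
def swap13 (d : ℕ) (x : Three d) : Three d := (x.2.2, (x.2.1, x.1))

/-- The exchange of the labels of systems 2 and 3. -/
def swap23 (d : ℕ) (x : Three d) : Three d := (x.1, (x.2.2, x.2.1))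

theorem swap12_involutive (d : ℕ) : Function.Involutive (swap12 d) := fun _ => rfl

theorem swap13_involutive (d : ℕ) : Function.Involutive (swap13 d) := fun _ => rfl

theorem swap23_involutive (d : ℕ) : Function.Involutive (swap23 d) := fun _ => rfl

/-- This is `e_i - e_a + e_b = -(e_a - e_i - e_b)`. The sign does not affect which labels share a
weight, so the fibers match those of the cloner. -/
theorem phaseWeight_hybrid {d : ℕ} (x : Three d) :
    phaseWeight 1 (-1) x = -phaseWeight 1 1 (swap12 d x) := by
  simp only [phaseWeight, swap12, one_smul, neg_smul]
  abel

theorem phaseWeight_hybridRev {d : ℕ} (x : Three d) :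
    phaseWeight (-1) 1 x = -phaseWeight 1 1 (swap13 d x) := by
  simp only [phaseWeight, swap13, one_smul, neg_smul]
  abel

theorem phaseWeight_hybrid_eq_iff {d : ℕ} (x y : Three d) :
    phaseWeight 1 (-1) x = phaseWeight 1 (-1) y ↔
      phaseWeight 1 1 (swap12 d x) = phaseWeight 1 1 (swap12 d y) := by
  rw [phaseWeight_hybrid, phaseWeight_hybrid, neg_inj]

theorem phaseWeight_hybridRev_eq_iff {d : ℕ} (x y : Three d) :
    phaseWeight (-1) 1 x = phaseWeight (-1) 1 y ↔
      phaseWeight 1 1 (swap13 d x) = phaseWeight 1 1 (swap13 d y) := by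
  rw [phaseWeight_hybridRev, phaseWeight_hybridRev, neg_inj]

theorem card_filter_eq_or_diag {d : ℕ} (i : Fin d) :
    (Finset.univ.filter fun p : Two d => p.1 = i ∨ p.1 = p.2).card = 2 * d - 1 := by
  have hset : (Finset.univ.filter fun p : Two d => p.1 = i ∨ p.1 = p.2) =
      Finset.univ.image (fun b : Fin d => (i, b)) ∪
        (Finset.univ.erase i).image (fun a : Fin d => (a, a)) := by
    ext ⟨a, b⟩
    simp only [Finset.mem_filter, Finset.mem_univ, true_and, Finset.mem_union, Finset.mem_image,
      Finset.mem_erase, Prod.mk.injEq, and_true]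
    constructor
    · rintro (rfl | rfl)
      · exact Or.inl ⟨b, rfl, rfl⟩
      · by_cases hi : a = i
        · exact Or.inl ⟨a, hi.symm, rfl⟩
        · exact Or.inr ⟨a, hi, rfl, rfl⟩
    · rintro (⟨_, rfl, rfl⟩ | ⟨_, -, rfl, rfl⟩)
      · exact Or.inl rfl
      · exact Or.inr rfl
  rw [hset, Finset.card_union_of_disjoint, Finset.card_image_of_injective,
    Finset.card_image_of_injective, Finset.card_erase_of_mem (Finset.mem_univ i)]
  · simp only [Finset.card_univ, Fintype.card_fin]
    have := i.pos
    omega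
  · intro j k h
    simpa using h
  · intro j k h
    simpa using h
  · rw [Finset.disjoint_left]
    simp only [Finset.mem_image, Finset.mem_univ, true_and, Finset.mem_erase]
    rintro _ ⟨j, rfl⟩ ⟨k, ⟨hk, -⟩, h⟩
    simp only [Prod.mk.injEq] at h
    exact hk h.1

theorem isCloningWeight_hybrid (d : ℕ) :
    IsCloningWeight (phaseWeight (d := d) 1 (-1)) fun x => inputCopied (swap12 d x) :=
  (isCloningWeight_cloner d).transport (swap12_involutive d).toPerm (fun _ _ => rfl)
    phaseWeight_hybrid_eq_iff card_filter_eq_or_diag (phaseWeight_input_injective 1 (-1))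

theorem isCloningWeight_hybridRev (d : ℕ) :
    IsCloningWeight (phaseWeight (d := d) (-1) 1) fun x => inputCopied (swap13 d x) :=
  (isCloningWeight_cloner d).transport (swap13_involutive d).toPerm (fun _ _ => rfl)
    phaseWeight_hybridRev_eq_iff
    (fun i => by
      rw [← card_filter_eq_or_diag i]
      exact Finset.card_equiv (Equiv.prodComm _ _) fun p => by
        simp [inputCopied, swap13, or_comm])
    (phaseWeight_input_injective (-1) 1)

/-! ### Optimal channels -/

theorem isOptimalProcessFidelity_of_isCloningWeight {d : ℕ} (hd : 1 ≤ d) (s t : ℤ)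
    {H : Three d → Prop} [DecidablePred H] (h : IsCloningWeight (phaseWeight s t) H)
    {Eid : Op (Fin d) → Op (Two d)}
    (hid : ∀ θ : Angles d, Eid (phaseState θ) = phaseState (s • θ) ⊗ₖ phaseState (t • θ)) :
    IsOptimalProcessFidelity Eid ((2 * (d : ℝ) - 1) / (d : ℝ) ^ 2) := by
  have hd0 : (0 : ℝ) < d := by exact_mod_cast hd
  have hM : ((2 * d - 1 : ℕ) : ℝ) = 2 * d - 1 := by
    rw [Nat.cast_sub (by omega)]
    simp
  constructor
  · refine ⟨_, h.isChannel_ofChoi hd, ?_⟩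
    rw [processFidelity_eq_sum hd s t hid (h.isChannel_ofChoi hd), choi_ofChoi,
      h.sum_optimalChoi hd, hM]
    field_simp
  · rintro _ ⟨E, hE, rfl⟩
    have hle := hE.posSemidef_choi.sum_fiber_re_le h.card_le
    rw [hE.trace_choi, Complex.natCast_re, hM] at hle
    rw [processFidelity_eq_sum hd s t hid hE]
    calc _ ≤ 1 / (d : ℝ) ^ 3 * ((2 * d - 1) * d) := by gcongr
      _ = _ := by field_simp

theorem average_choi_of_isOptimalChannel {d : ℕ} (hd : 1 ≤ d) (s t : ℤ)
    {H : Three d → Prop} [DecidablePred H] (h : IsCloningWeight (phaseWeight s t) H)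
    {Eid : Op (Fin d) → Op (Two d)}
    (hid : ∀ θ : Angles d, Eid (phaseState θ) = phaseState (s • θ) ⊗ₖ phaseState (t • θ))
    {E : Op (Fin d) →ₗ[ℂ] Op (Two d)} (hE : IsOptimalChannel Eid E)
    {v : Three d → Three d} (hv : Function.Involutive v)
    (hvw : ∀ x, phaseWeight s t (v x) = phaseWeight s t x) :
    average (fun θ => phaseOp θ ⊗ₖ (phaseOp (-(s • θ)) ⊗ₖ phaseOp (-(t • θ)))) (basisOp v)
      (choi E) = optimalChoi (phaseWeight s t) H := by
  have hd0 : (0 : ℝ) < d := by exact_mod_cast hd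
  have hM : ((2 * d - 1 : ℕ) : ℝ) = 2 * d - 1 := by
    rw [Nat.cast_sub (by omega)]
    simp
  -- Optimality fixes the value of the fidelity, which is exactly the equality case of the fiber
  -- bound.
  have hval := hE.2.unique (isOptimalProcessFidelity_of_isCloningWeight hd s t h hid)
  rw [processFidelity_eq_sum hd s t hid hE.1] at hval
  simp only [phaseOp_kronecker]
  refine h.average_eq hd hv hvw hE.1.posSemidef_choi hE.1.trace_choi ?_
  rw [hM]
  field_simp at hval
  linarith

theorem mainTheorem5 (d : ℕ) (hd : 1 ≤ d)
    (Ecl Ehy Erev : Op (Fin d) → Op (Two d))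
    (hcl : IsIdealCloner Ecl) (hhy : IsIdealHybrid Ehy) (hrev : IsIdealHybridRev Erev) :
    IsOptimalProcessFidelity Ecl ((2 * (d : ℝ) - 1) / (d : ℝ) ^ 2) ∧
    IsOptimalProcessFidelity Ehy ((2 * (d : ℝ) - 1) / (d : ℝ) ^ 2) ∧
    IsOptimalProcessFidelity Erev ((2 * (d : ℝ) - 1) / (d : ℝ) ^ 2) ∧
    (∀ E F : Op (Fin d) →ₗ[ℂ] Op (Two d), IsOptimalChannel Ecl E → IsOptimalChannel Ehy F →
      avgChoiHybrid F = V12 d * avgChoiCloner E * V12 d) ∧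
    (∀ E F : Op (Fin d) →ₗ[ℂ] Op (Two d), IsOptimalChannel Ecl E → IsOptimalChannel Erev F →
      avgChoiHybridRev F = V13 d * avgChoiCloner E * V13 d) := by
  have hcl' : ∀ θ : Angles d, Ecl (phaseState θ) =
      phaseState ((1 : ℤ) • θ) ⊗ₖ phaseState ((1 : ℤ) • θ) := by simpa [IsIdealCloner] using hcl
  have hhy' : ∀ θ : Angles d, Ehy (phaseState θ) =
      phaseState ((1 : ℤ) • θ) ⊗ₖ phaseState ((-1 : ℤ) • θ) := by simpa [IsIdealHybrid] using hhy
  have hrev' : ∀ θ : Angles d, Erev (phaseState θ) =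
      phaseState ((-1 : ℤ) • θ) ⊗ₖ phaseState ((1 : ℤ) • θ) := by simpa [IsIdealHybridRev] using hrev
  have havg : ∀ E, IsOptimalChannel Ecl E →
      avgChoiCloner E = optimalChoi (phaseWeight 1 1) inputCopied := fun E hE => by
    have h := average_choi_of_isOptimalChannel hd 1 1 (isCloningWeight_cloner d) hcl' hE
      (swap23_involutive d) fun x => by
        simp only [phaseWeight, swap23]
        abel
    simp only [one_smul] at h
    exact h
  refine ⟨isOptimalProcessFidelity_of_isCloningWeight hd 1 1 (isCloningWeight_cloner d) hcl',
    isOptimalProcessFidelity_of_isCloningWeight hd 1 (-1) (isCloningWeight_hybrid d) hhy',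
    isOptimalProcessFidelity_of_isCloningWeight hd (-1) 1 (isCloningWeight_hybridRev d) hrev',
    fun E F hE hF => ?_, fun E F hE hF => ?_⟩
  · have h : avgChoiHybrid F = optimalChoi (phaseWeight 1 (-1)) fun x =>
        inputCopied (swap12 d x) := by
      have h := average_choi_of_isOptimalChannel hd 1 (-1) (isCloningWeight_hybrid d) hhy' hF
        (swap13_involutive d) fun x => by
          simp only [phaseWeight, swap13, one_smul, neg_smul]
          abel
      simp only [one_smul, neg_smul, neg_neg] at h
      exact h
    rw [h, havg E hE]
    ext x y
    -- `V12` is self-adjoint, so multiplying by it on both sides relabels entries by `swap12`, which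
    -- matches the hybrid fibers and heavy labels with those of the cloner.
    have hv := basisOp_conj_apply_of_involutive (swap12_involutive d)
      (optimalChoi (phaseWeight 1 1) inputCopied) x y
    rw [basisOp_conjTranspose_of_involutive (swap12_involutive d)] at hv
    refine Eq.trans ?_ hv.symm
    simp only [optimalChoi, of_apply, phaseWeight_hybrid_eq_iff]
  · have h : avgChoiHybridRev F = optimalChoi (phaseWeight (-1) 1) fun x =>
        inputCopied (swap13 d x) := by
      have h := average_choi_of_isOptimalChannel hd (-1) 1 (isCloningWeight_hybridRev d) hrev' hF
        (swap12_involutive d) fun x => by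
          simp only [phaseWeight, swap12, one_smul, neg_smul]
          abel
      simp only [one_smul, neg_smul, neg_neg] at h
      exact h
    rw [h, havg E hE]
    ext x y
    have hv := basisOp_conj_apply_of_involutive (swap13_involutive d)
      (optimalChoi (phaseWeight 1 1) inputCopied) x y
    rw [basisOp_conjTranspose_of_involutive (swap13_involutive d)] at hv
    refine Eq.trans ?_ hv.symm
    simp only [optimalChoi, of_apply, phaseWeight_hybridRev_eq_iff]
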